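/- Let $K$ be a field and let $G$ be a finite graph (no loops, no multiple edges, no isolated vertices) on the vertex set $\{x_1,\dots,x_n\}$, $n\ge 2$. Let $I(G)\subset K[x_1,\dots,x_n]$ be its edge ideal, generated by the products $x_ix_j$ with $\{x_i,x_j\}$ an edge of $G$. For $\mathfrak c=(c_1,\dots,c_n)\in(\mathbb Z_{>0})^n$ and $q\ge 1$, let $(I(G)^q)_{\mathfrak c}$ be the ideal generated by the monomials $x_1^{a_1}\cdots x_n^{a_n}\in I(G)^q$ with $a_i\le c_i$ for all $i$, and let $\delta=\delta_{\mathfrak c}(I(G))$ be the largest $q\ge 1$ with $(I(G)^q)_{\mathfrak c}\neq (0)$. Let $\mathcal B(G,\mathfrak c)$ be the minimal set of monomial generators of $(I(G)^{\delta})_{\mathfrak c}$, and let $\mathcal D(G,\mathfrak c)\subset\mathbb Z^n$ be the set of exponent vectors of all monomials dividing some element of $\mathcal B(G,\mathfrak c)$. A polytope $\mathcal P\subset\mathbb R^n$ of dimension $n$ with vertices in $\mathbb Z^n$ is called normal if, for every $N\ge 2$, each point of $N\mathcal P\cap\mathbb Z^n$ is a sum of $N$ points of $\mathcal P\cap\mathbb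 Z^n$; a normal polytope is called pseudo-Gorenstein* if its interior contains exactly one point of $\mathbb Z^n$. The graph $G$ is called labeling pseudo-Gorenstein* if there is $\mathfrak c\in(\mathbb Z_{>0})^n$ such that the convex hull of $\mathcal D(G,\mathfrak c)$ in $\mathbb R^n$ is pseudo-Gorenstein*. **Theorem.** Let $T$ be a tree on $n\ge 2$ vertices. Then the following conditions are equivalent: (i) $T$ is labeling pseudo-Gorenstein*. (ii) If $x$ and $y$ are leaves of $T$ (vertices of degree $1$), then $\operatorname{dist}(x,y)\neq 2$. -/

import Mathlib

open scoped Pointwise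

noncomputable section

/-! ### Lattice polytopes in `ℝ^ι` -/

/-- The lattice `ℤ^ι` inside `ℝ^ι`. -/
def latticePoints (ι : Type*) : Set (ι → ℝ) :=
  Set.range fun (a : ι → ℤ) (i : ι) => (a i : ℝ)

/-- A full-dimensional lattice polytope: the convex hull of a finite set, whose affine span is the
whole space and all of whose vertices (extreme points) are lattice points. -/
def IsLatticePolytope {ι : Type*} (P : Set (ι → ℝ)) : Prop :=
  (∃ s : Set (ι → ℝ), s.Finite ∧ P = convexHull ℝ s) ∧
    affineSpan ℝ P = ⊤ ∧
    P.extremePoints ℝ ⊆ latticePoints ι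

/-- A normal polytope: a full-dimensional lattice polytope `P` such that for `N ≥ 2` each lattice
point of `N P` is a sum of `N` lattice points of `P`. -/
def IsNormalPolytope {ι : Type*} (P : Set (ι → ℝ)) : Prop :=
  IsLatticePolytope P ∧
    ∀ N : ℕ, 2 ≤ N → ∀ a ∈ ((N : ℝ) • P) ∩ latticePoints ι,
      ∃ b : Fin N → (ι → ℝ), (∀ k, b k ∈ P ∩ latticePoints ι) ∧ a = ∑ k, b k

/-- A pseudo-Gorenstein* polytope: a normal polytope with exactly one lattice point in its
interior. -/
def IsPseudoGorensteinStar {ι : Type*} (P : Set (ι → ℝ)) : Prop :=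
  IsNormalPolytope P ∧ (interior P ∩ latticePoints ι).ncard = 1

/-! ### Bounded powers of edge ideals

A monomial of `MvPolynomial V K` is represented by its exponent vector in `V →₀ ℕ`. -/

/-- The edge ideal of `G`, generated by the `x_i x_j` with `{i, j}` an edge of `G`. -/
def edgeIdeal {V : Type*} (K : Type*) [Field K] (G : SimpleGraph V) : Ideal (MvPolynomial V K) :=
  Ideal.span {p | ∃ i j : V, G.Adj i j ∧ p = MvPolynomial.X i * MvPolynomial.X j}

/-- The ideal `I_c` generated by those monomials `x^a ∈ I` for which `a_i ≤ c_i` for all `i`. -/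
def boundedIdeal {V K : Type*} [Field K] (I : Ideal (MvPolynomial V K)) (c : V → ℕ) :
    Ideal (MvPolynomial V K) :=
  Ideal.span {p | ∃ a : V →₀ ℕ, (∀ i, a i ≤ c i) ∧ MvPolynomial.monomial a (1 : K) ∈ I ∧
    p = MvPolynomial.monomial a (1 : K)}

/-- `δ_c(I)`: the biggest `q ≥ 1` with `(I ^ q)_c ≠ 0`. -/
def maxBoundedPower {V K : Type*} [Field K] (I : Ideal (MvPolynomial V K)) (c : V → ℕ) : ℕ :=
  sSup {q : ℕ | 1 ≤ q ∧ boundedIdeal (I ^ q) c ≠ ⊥}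

/-- The minimal set of monomial generators of a monomial ideal (as exponent vectors): the monomials
of the ideal that are minimal with respect to divisibility. -/
def minimalMonomialGenerators {V K : Type*} [Field K] (J : Ideal (MvPolynomial V K)) :
    Set (V →₀ ℕ) :=
  {u | Minimal (fun a : V →₀ ℕ => MvPolynomial.monomial a (1 : K) ∈ J) u}

/-- `B(G, c)`: the minimal monomial generators of `(I(G) ^ δ)_c`, where `δ = δ_c(I(G))`. -/
def topBoundedGenerators {V : Type*} (K : Type*) [Field K] (G : SimpleGraph V) (c : V → ℕ) :
    Set (V →₀ ℕ) :=
  minimalMonomialGenerators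
    (boundedIdeal (edgeIdeal K G ^ maxBoundedPower (edgeIdeal K G) c) c)

/-- `D(G, c) ⊆ ℤ^V`: the exponent vectors of the monomials dividing some element of `B(G, c)`. -/
def boundedPolymatroid {V : Type*} (K : Type*) [Field K] (G : SimpleGraph V) (c : V → ℕ) :
    Set (V → ℤ) :=
  {z | ∃ u ∈ topBoundedGenerators K G c, ∃ a : V →₀ ℕ, a ≤ u ∧ ∀ v, z v = (a v : ℤ)}

/-- `conv(D(G, c)) ⊆ ℝ^V`. -/
def boundedPolytope {V : Type*} (K : Type*) [Field K] (G : SimpleGraph V) (c : V → ℕ) :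
    Set (V → ℝ) :=
  convexHull ℝ ((fun (z : V → ℤ) (v : V) => (z v : ℝ)) '' boundedPolymatroid K G c)

/-- `G` is labeling pseudo-Gorenstein*: `conv(D(G, c))` is pseudo-Gorenstein* for some vector `c` of
positive integers. -/
def IsLabelingPseudoGorensteinStar {V : Type*} (K : Type*) [Field K] (G : SimpleGraph V) : Prop :=
  ∃ c : V → ℕ, (∀ v, 0 < c v) ∧ IsPseudoGorensteinStar (boundedPolytope K G c)

end

/-! Monomials of a bounded power of the edge ideal correspond to multisets of edges ("packings")
with degrees bounded by `c`. Thus `D(G, c)` consists of the nonnegative integer vectors dominated by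
the degree vector of a packing of maximal size (`mem_boundedPolymatroid`).

If leaves are never at distance 2, the constant label 2 works. A tree is bipartite, so Hall's
theorem on each side, Mendelsohn–Dulmage and exchange show that the inequalities `w v ≤ d` and `w(A)
≤ d * |N(A)|` suffice for `w` to lie in `D(T, d)`. Packings with bound `N * d` split into `N`
packings with bound `d`, which gives normality. Interior points satisfy `0 < p v < 2`, so only the
all-one vector can be an interior lattice point; it is one because the leaf condition forces `|A| <
2 * |N(A)|` for nonempty `A`.

Conversely, let leaves `x`, `y` share a neighbour `z`, and let `a` be an interior lattice point.
Then `c x, c y ≥ 2` and `c z ≥ 3`, and every maximal packing has degree at least 3 at `z`. Hence the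
`z`-coordinate of `a` can be set to 1 or to 2, giving two interior lattice points. This direction
needs no tree. -/

theorem Nat.exists_forall_le_of_bounded {α : Type*} {P : α → Prop} (f : α → ℕ) (b : ℕ)
    (hb : ∀ a, P a → f a ≤ b) (hP : ∃ a, P a) : ∃ a, P a ∧ ∀ a', P a' → f a' ≤ f a := by
  obtain ⟨a, ha, hmin⟩ := (measure fun a => b - f a).wf.has_min {a | P a} hP
  refine ⟨a, ha, fun a' ha' => ?_⟩
  have h1 : ¬ (b - f a' < b - f a) := hmin a' ha'
  have h2 := hb a' ha'
  omega

/-! ### Multisets of edges with bounded degrees -/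

open Classical in
/-- The degree of the vertex `v` in the multiset of edges `M`. -/
noncomputable def edgeDegree {V : Type*} (M : Multiset (Sym2 V)) (v : V) : ℕ :=
  M.countP (v ∈ ·)

section EdgeDegree

variable {V : Type*}

@[simp] theorem edgeDegree_zero (v : V) : edgeDegree (0 : Multiset (Sym2 V)) v = 0 := by
  simp [edgeDegree]

theorem edgeDegree_add (M N : Multiset (Sym2 V)) (v : V) :
    edgeDegree (M + N) v = edgeDegree M v + edgeDegree N v := by
  simp [edgeDegree]

open Classical in
theorem edgeDegree_cons (e : Sym2 V) (M : Multiset (Sym2 V)) (v : V) :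
    edgeDegree (e ::ₘ M) v = edgeDegree M v + if v ∈ e then 1 else 0 := by
  simp [edgeDegree, Multiset.countP_cons]

theorem edgeDegree_sum {ι : Type*} (s : Finset ι) (f : ι → Multiset (Sym2 V)) (v : V) :
    edgeDegree (∑ k ∈ s, f k) v = ∑ k ∈ s, edgeDegree (f k) v := by
  classical
  induction s using Finset.induction_on with
  | empty => simp
  | insert a s ha ih => simp [Finset.sum_insert ha, edgeDegree_add, ih]

theorem sum_edgeDegree [Fintype V] (G : SimpleGraph V) (M : Multiset (Sym2 V))
    (hM : ∀ e ∈ M, e ∈ G.edgeSet) : ∑ v, edgeDegree M v = 2 * M.card := by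
  classical
  induction M using Multiset.induction_on with
  | empty => simp
  | cons e M ih =>
    have h2 : ∑ v, (if v ∈ e then 1 else 0) = 2 := by
      have he := hM e (Multiset.mem_cons_self e M)
      induction e with
      | _ x y =>
        have hxy : x ≠ y := G.ne_of_adj he
        rw [Finset.sum_boole]
        have : (Finset.univ.filter fun v => v ∈ s(x, y)) = {x, y} := by ext v; simp
        rw [this, Finset.card_pair hxy, Nat.cast_id]
    simp only [edgeDegree_cons, Finset.sum_add_distrib, h2, Multiset.card_cons]
    rw [ih fun e he => hM e (Multiset.mem_cons_of_mem he)]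
    ring

open Classical in
theorem exists_count_lt_of_edgeDegree_lt {M N : Multiset (Sym2 V)} {v : V}
    (h : edgeDegree M v < edgeDegree N v) : ∃ e, v ∈ e ∧ M.count e < N.count e := by
  by_contra! hc
  refine h.not_ge ?_
  rw [edgeDegree, edgeDegree, Multiset.countP_eq_card_filter, Multiset.countP_eq_card_filter]
  refine Multiset.card_le_card (Multiset.le_iff_count.2 fun e => ?_)
  by_cases he : v ∈ e
  · simpa [Multiset.count_filter, he] using hc e he
  · simp [he]

open Classical in
theorem exists_count_lt_of_edgeDegree_le {M N : Multiset (Sym2 V)} {v : V} {e : Sym2 V}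
    (h : edgeDegree N v ≤ edgeDegree M v) (hve : v ∈ e) (he : M.count e < N.count e) :
    ∃ f, v ∈ f ∧ N.count f < M.count f := by
  by_contra! hc
  have hle : M.filter (v ∈ ·) ≤ N.filter (v ∈ ·) := by
    refine Multiset.le_iff_count.2 fun f => ?_
    by_cases hf : v ∈ f
    · simpa [Multiset.count_filter, hf] using hc f hf
    · simp [hf]
  rw [edgeDegree, edgeDegree, Multiset.countP_eq_card_filter,
    Multiset.countP_eq_card_filter] at h
  have := congrArg (Multiset.count e) (Multiset.eq_of_le_of_card_le hle h)
  simp only [Multiset.count_filter, hve, if_true] at this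
  omega

end EdgeDegree

/-- `M` is a multiset of edges of `G` in which every vertex `v` has degree at most `c v`. -/
structure IsEdgePacking {V : Type*} (G : SimpleGraph V) (c : V → ℕ) (M : Multiset (Sym2 V)) :
    Prop where
  mem_edgeSet : ∀ e ∈ M, e ∈ G.edgeSet
  degree_le : ∀ v, edgeDegree M v ≤ c v

/-- `M` is an edge packing of maximal size. -/
structure IsMaxEdgePacking {V : Type*} (G : SimpleGraph V) (c : V → ℕ) (M : Multiset (Sym2 V)) :
    Prop extends IsEdgePacking G c M where
  card_le : ∀ M', IsEdgePacking G c M' → M'.card ≤ M.card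

/-! ### Exchange arguments for packings -/

section Packing

variable {V : Type*} {G : SimpleGraph V} {c : V → ℕ}

theorem isEdgePacking_zero : IsEdgePacking G c 0 := ⟨by simp, by simp⟩

theorem IsEdgePacking.cons {M : Multiset (Sym2 V)} (hM : IsEdgePacking G c M) {x y : V}
    (hxy : G.Adj x y) (hx : edgeDegree M x < c x) (hy : edgeDegree M y < c y) :
    IsEdgePacking G c (s(x, y) ::ₘ M) := by
  classical
  refine ⟨fun e he => ?_, fun v => ?_⟩
  · rcases Multiset.mem_cons.1 he with rfl | he
    · exact hxy
    · exact hM.mem_edgeSet e he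
  · rw [edgeDegree_cons]
    have := hM.degree_le v
    split_ifs with h
    · rcases Sym2.mem_iff.1 h with rfl | rfl <;> omega
    · omega

theorem IsEdgePacking.two_mul_card_le [Fintype V] {M : Multiset (Sym2 V)}
    (hM : IsEdgePacking G c M) : 2 * M.card ≤ ∑ v, c v := by
  rw [← sum_edgeDegree G M hM.mem_edgeSet]
  exact Finset.sum_le_sum fun v _ => hM.degree_le v

open Classical in
/-- Exchange step: moving a packing towards another one along an edge at a vertex of deficient
degree. -/
theorem IsEdgePacking.exists_exchange {M N : Multiset (Sym2 V)} (hM : IsEdgePacking G c M)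
    (hN : IsEdgePacking G c N) {x : V} (hx : edgeDegree M x < edgeDegree N x) :
    ∃ M' y, IsEdgePacking G c M' ∧ M.card ≤ M'.card ∧ (M ∩ N).card < (M' ∩ N).card ∧
      G.Adj x y ∧ ∀ v, ¬ G.Adj y v → edgeDegree M v ≤ edgeDegree M' v := by
  obtain ⟨e, hxe, he⟩ := exists_count_lt_of_edgeDegree_lt hx
  obtain ⟨y, rfl⟩ := Sym2.mem_iff_exists.1 hxe
  have hadj : G.Adj x y := hN.mem_edgeSet _ (Multiset.count_pos.1 ((Nat.zero_le _).trans_lt he))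
  have hNx := hN.degree_le x
  have hNy := hN.degree_le y
  by_cases hy : edgeDegree M y < c y
  · refine ⟨s(x, y) ::ₘ M, y, hM.cons hadj (by omega) hy, by simp, ?_, hadj, fun v _ => ?_⟩
    · refine Multiset.card_lt_card (lt_of_le_of_ne (Multiset.le_iff_count.2 fun g => ?_) ?_)
      · simp only [Multiset.count_inter]
        exact min_le_min_right _ (Multiset.count_le_count_cons _ _ _)
      · intro h
        have := congrArg (Multiset.count s(x, y)) h
        simp only [Multiset.count_inter, Multiset.count_cons_self] at this
        omega
    · rw [edgeDegree_cons]; omega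
  -- `y` is saturated in `M`, so the surplus of `s(x, y)` in `N` is offset by an edge at `y` that
  -- `M` uses more often than `N`. Swapping that edge for `s(x, y)` keeps the degree of `y`.
  · obtain ⟨f, hyf, hf⟩ := exists_count_lt_of_edgeDegree_le (by omega)
      (Sym2.mem_mk_right x y) he
    have hfM : f ∈ M := Multiset.count_pos.1 ((Nat.zero_le _).trans_lt hf)
    obtain ⟨R, rfl⟩ := Multiset.exists_cons_of_mem hfM
    obtain ⟨z, rfl⟩ := Sym2.mem_iff_exists.1 hyf
    have hyz : G.Adj y z := hM.mem_edgeSet _ hfM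
    have hne : s(x, y) ≠ s(y, z) := by
      intro h
      rw [h] at he
      omega
    have hxz : x ≠ z := by
      rintro rfl
      exact hne Sym2.eq_swap
    have hxy : x ≠ y := hadj.ne
    refine ⟨s(x, y) ::ₘ R, y, ⟨fun g hg => ?_, fun v => ?_⟩, by simp, ?_, hadj, fun v hv => ?_⟩
    · rcases Multiset.mem_cons.1 hg with rfl | hg
      · exact hadj
      · exact hM.mem_edgeSet g (Multiset.mem_cons_of_mem hg)
    · have h1 := hM.degree_le v
      rw [edgeDegree_cons] at h1 ⊢
      by_cases hvy : v = y
      · subst hvy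
        simpa using h1
      by_cases hvx : v = x
      · subst hvx
        rw [edgeDegree_cons] at hx
        simp [hxy, hxz] at hx ⊢
        omega
      · simp [hvy, hvx] at h1 ⊢
        omega
    · refine Multiset.card_lt_card (lt_of_le_of_ne (Multiset.le_iff_count.2 fun g => ?_) ?_)
      · simp only [Multiset.count_inter, Multiset.count_cons] at hf ⊢
        by_cases hg : g = s(y, z)
        · subst hg
          simp at hf
          simp
          omega
        · simp only [hg, if_false]
          split_ifs <;> omega
      · intro h
        have := congrArg (Multiset.count s(x, y)) h
        simp only [Multiset.count_inter, Multiset.count_cons, hne, if_true, if_false] at this he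
        omega
    · rw [edgeDegree_cons, edgeDegree_cons]
      by_cases hvy : v = y
      · simp [hvy]
      · have hvz : v ≠ z := by
          rintro rfl
          exact hv hyz
        simp [hvy, hvz]

/-- Every packing is dominated by one of maximal size. -/
theorem IsEdgePacking.exists_max_degree_le [Fintype V] {M : Multiset (Sym2 V)}
    (hM : IsEdgePacking G c M) :
    ∃ M', IsMaxEdgePacking G c M' ∧ ∀ v, edgeDegree M v ≤ edgeDegree M' v := by
  classical
  have hmax : ∃ N, IsMaxEdgePacking G c N := by
    obtain ⟨N, hN, h⟩ := Nat.exists_forall_le_of_bounded (P := IsEdgePacking G c) Multiset.card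
      (∑ v, c v) (fun N hN => by have := hN.two_mul_card_le; omega) ⟨M, hM⟩
    exact ⟨N, hN, h⟩
  -- Among maximal packings take one with the largest overlap with `M`; an exchange at a deficient
  -- vertex would enlarge the overlap without losing size.
  obtain ⟨N, hN, h⟩ := Nat.exists_forall_le_of_bounded (P := IsMaxEdgePacking G c)
    (fun N => (N ∩ M).card) M.card (fun N _ => Multiset.card_le_card Multiset.inter_le_right) hmax
  refine ⟨N, hN, fun v => ?_⟩
  by_contra! hv
  obtain ⟨N', y, hN', hcard, hlt, -⟩ := hN.toIsEdgePacking.exists_exchange hM hv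
  exact (h N' ⟨hN', fun K hK => (hN.card_le K hK).trans hcard⟩).not_gt hlt

/-- The Mendelsohn–Dulmage theorem for edge packings of a bipartite graph. -/
theorem IsEdgePacking.exists_mendelsohn_dulmage {X : Set V}
    (hX : ∀ x y, G.Adj x y → (x ∈ X ↔ y ∉ X)) {M N : Multiset (Sym2 V)} {w : V → ℕ}
    (hM : IsEdgePacking G c M) (hMw : ∀ v ∈ X, w v ≤ edgeDegree M v)
    (hN : IsEdgePacking G c N) (hNw : ∀ v ∉ X, w v ≤ edgeDegree N v) :
    ∃ L, IsEdgePacking G c L ∧ ∀ v, w v ≤ edgeDegree L v := by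
  classical
  obtain ⟨L, ⟨hL, hLw⟩, h⟩ := Nat.exists_forall_le_of_bounded
    (P := fun L => IsEdgePacking G c L ∧ ∀ v ∈ X, w v ≤ edgeDegree L v)
    (fun L => (L ∩ N).card) N.card (fun L _ => Multiset.card_le_card Multiset.inter_le_right)
    ⟨M, hM, hMw⟩
  refine ⟨L, hL, fun v => ?_⟩
  by_cases hv : v ∈ X
  · exact hLw v hv
  by_contra! hlt
  obtain ⟨L', y, hL', -, hcard, hvy, hdeg⟩ := hL.exists_exchange hN (hlt.trans_le (hNw v hv))
  -- Since `v ∉ X`, its neighbour `y` lies in `X` and all neighbours of `y` lie outside `X`. Only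
  -- those can lose degree, so the bounds on `X` survive.
  refine (h L' ⟨hL', fun u hu => (hLw u hu).trans (hdeg u fun hyu => ?_)⟩).not_gt hcard
  have h1 := hX v y hvy
  have h2 := hX y u hyu
  tauto

end Packing

/-! ### Hall's condition -/

open Classical in
/-- The set of vertices with a neighbour in `A`. -/
noncomputable def SimpleGraph.finsetNeighbors {V : Type*} [Fintype V] (G : SimpleGraph V)
    (A : Finset V) : Finset V :=
  Finset.univ.filter fun v => ∃ a ∈ A, G.Adj a v

theorem SimpleGraph.mem_finsetNeighbors {V : Type*} [Fintype V] {G : SimpleGraph V}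
    {A : Finset V} {v : V} : v ∈ G.finsetNeighbors A ↔ ∃ a ∈ A, G.Adj a v := by
  simp [SimpleGraph.finsetNeighbors]

/-- An edge contributes to the left once for each endpoint in `A`, and the opposite endpoint then
lies in the neighbourhood of `A`. -/
theorem sum_edgeDegree_le {V : Type*} [Fintype V] {G : SimpleGraph V} {M : Multiset (Sym2 V)}
    (hM : ∀ e ∈ M, e ∈ G.edgeSet) (A : Finset V) :
    ∑ v ∈ A, edgeDegree M v ≤ ∑ u ∈ G.finsetNeighbors A, edgeDegree M u := by
  classical
  induction M using Multiset.induction_on with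
  | empty => simp
  | cons e M ih =>
    simp only [edgeDegree_cons, Finset.sum_add_distrib]
    refine add_le_add (ih fun e he => hM e (Multiset.mem_cons_of_mem he)) ?_
    have he := hM e (Multiset.mem_cons_self e M)
    induction e with
    | _ x y =>
      have hxy : G.Adj x y := he
      rw [Finset.sum_boole, Finset.sum_boole, Nat.cast_id, Nat.cast_id]
      refine Finset.card_le_card_of_injOn (fun v => if v = x then y else x) ?_ ?_
      · intro v hv
        simp only [Finset.coe_filter, Set.mem_ofPred_eq, Sym2.mem_iff] at hv ⊢
        obtain ⟨hvA, rfl | rfl⟩ := hv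
        · simpa [SimpleGraph.mem_finsetNeighbors] using ⟨v, hvA, hxy⟩
        · simpa [SimpleGraph.mem_finsetNeighbors, hxy.ne'] using ⟨v, hvA, hxy.symm⟩
      · intro v hv v' hv' h
        have := hxy.ne
        simp only [Finset.coe_filter, Set.mem_ofPred_eq, Sym2.mem_iff] at hv hv' h
        grind

section Hall

variable {V : Type*} [Fintype V] {G : SimpleGraph V}

/-- Hall's theorem is applied to `w v` copies of each vertex `v`, to be matched with `d` slots at
each neighbour. -/
theorem exists_isEdgePacking_of_hall_on {X : Set V} (hX : ∀ x y, G.Adj x y → (x ∈ X ↔ y ∉ X))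
    {w : V → ℕ} {d : ℕ} (hwd : ∀ v, w v ≤ d)
    (hall : ∀ A : Finset V, ∑ v ∈ A, w v ≤ d * (G.finsetNeighbors A).card) :
    ∃ M, IsEdgePacking G (fun _ => d) M ∧ ∀ v ∈ X, w v ≤ edgeDegree M v := by
  classical
  let t : (Σ v, Fin (w v)) → Finset (V × Fin d) := fun p =>
    G.finsetNeighbors {p.1} ×ˢ Finset.univ
  obtain ⟨f, hf, hft⟩ := (Finset.all_card_le_biUnion_card_iff_exists_injective t).1 (by
    intro S
    have h1 : S.biUnion t = G.finsetNeighbors (S.image Sigma.fst) ×ˢ Finset.univ := by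
      ext ⟨u, j⟩
      simp [t, SimpleGraph.mem_finsetNeighbors]
    have h2 : S ⊆ (S.image Sigma.fst).sigma fun _ => Finset.univ := fun p hp => by
      simp only [Finset.mem_sigma, Finset.mem_univ, and_true]
      exact Finset.mem_image_of_mem _ hp
    have h3 := Finset.card_le_card h2
    rw [Finset.card_sigma] at h3
    simp only [Finset.card_univ, Fintype.card_fin] at h3
    rw [h1, Finset.card_product, Finset.card_univ, Fintype.card_fin, mul_comm]
    exact h3.trans (hall _))
  have hadj : ∀ p, G.Adj p.1 (f p).1 := fun p => by
    simpa [t, SimpleGraph.mem_finsetNeighbors] using hft p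
  -- Only edges issued from `X` are kept. Then vertices of `X` have degree exactly `w v`, and
  -- injectivity of the matching bounds the other degrees by `d`.
  let S : Finset (Σ v, Fin (w v)) := Finset.univ.filter fun p => p.1 ∈ X
  let M : Multiset (Sym2 V) := S.val.map fun p => s(p.1, (f p).1)
  have hdeg : ∀ v, edgeDegree M v = (S.filter fun p => v ∈ s(p.1, (f p).1)).card := fun v => by
    simp only [edgeDegree, M, Multiset.countP_map]
    rfl
  have hin : ∀ v ∈ X, edgeDegree M v = w v := fun v hv => by
    rw [hdeg]
    have : (S.filter fun p => v ∈ s(p.1, (f p).1)) =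
        ({v} : Finset V).sigma fun _ => Finset.univ := by
      ext p
      have := hX _ _ (hadj p)
      simp only [S, Finset.mem_filter, Finset.mem_univ, true_and, Sym2.mem_iff,
        Finset.mem_sigma, Finset.mem_singleton, and_true]
      constructor
      · rintro ⟨hp, rfl | rfl⟩
        · rfl
        · exact absurd hv (this.1 hp)
      · rintro rfl
        exact ⟨hv, Or.inl rfl⟩
    rw [this, Finset.card_sigma]
    simp
  refine ⟨M, ⟨fun e he => ?_, fun v => ?_⟩, fun v hv => (hin v hv).ge⟩
  · obtain ⟨p, -, rfl⟩ := Multiset.mem_map.1 he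
    exact hadj p
  · by_cases hv : v ∈ X
    · exact (hin v hv).trans_le (hwd v)
    · rw [hdeg]
      calc _ ≤ (({v} : Finset V) ×ˢ (Finset.univ : Finset (Fin d))).card := by
            refine Finset.card_le_card_of_injOn f (fun p hp => ?_) hf.injOn
            simp only [S, Finset.coe_filter, Finset.mem_filter, Finset.mem_univ, true_and,
              Set.mem_ofPred_eq, Sym2.mem_iff] at hp
            obtain ⟨hp, rfl | h⟩ := hp
            · exact absurd hp hv
            · simp [h]
        _ = d := by simp

/-- In a bipartite graph, Hall's condition for all sets of vertices yields a packing of maximal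
size which covers the prescribed degrees. -/
theorem exists_isMaxEdgePacking_of_hall {X : Set V}
    (hX : ∀ x y, G.Adj x y → (x ∈ X ↔ y ∉ X)) {w : V → ℕ} {d : ℕ} (hwd : ∀ v, w v ≤ d)
    (hall : ∀ A : Finset V, ∑ v ∈ A, w v ≤ d * (G.finsetNeighbors A).card) :
    ∃ M, IsMaxEdgePacking G (fun _ => d) M ∧ ∀ v, w v ≤ edgeDegree M v := by
  obtain ⟨M₁, hM₁, h₁⟩ := exists_isEdgePacking_of_hall_on hX hwd hall
  obtain ⟨M₂, hM₂, h₂⟩ := exists_isEdgePacking_of_hall_on (X := Xᶜ)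
    (fun x y h => by have := hX x y h; simp only [Set.mem_compl_iff]; tauto) hwd hall
  obtain ⟨L, hL, hw⟩ := IsEdgePacking.exists_mendelsohn_dulmage hX hM₁ h₁ hM₂ h₂
  obtain ⟨M, hM, h⟩ := hL.exists_max_degree_le
  exact ⟨M, hM, fun v => (hw v).trans (h v)⟩

end Hall

/-! ### Combinatorics of trees -/

section Tree

variable {V : Type*} {T : SimpleGraph V}

/-- Uniqueness of the parent of `v` for the root `r`: it is the penultimate vertex of the unique
path from `r` to `v`. -/
theorem SimpleGraph.IsTree.eq_of_adj_of_dist_eq_add_one (hT : T.IsTree) {r v p q : V}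
    (hp : T.Adj p v) (hq : T.Adj q v) (hpd : T.dist r v = T.dist r p + 1)
    (hqd : T.dist r v = T.dist r q + 1) : p = q := by
  obtain ⟨a, ha⟩ := hT.connected.exists_walk_length_eq_dist r p
  obtain ⟨b, hb⟩ := hT.connected.exists_walk_length_eq_dist r q
  have ha' := (a.concat hp).isPath_of_length_eq_dist (by rw [Walk.length_concat]; omega)
  have hb' := (b.concat hq).isPath_of_length_eq_dist (by rw [Walk.length_concat]; omega)
  have h := (hT.existsUnique_path r v).unique ha' hb'
  simpa using congrArg Walk.penultimate h

theorem SimpleGraph.IsTree.exists_bipartition (hT : T.IsTree) :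
    ∃ X : Set V, ∀ x y, T.Adj x y → (x ∈ X ↔ y ∉ X) := by
  obtain ⟨r⟩ := hT.connected.nonempty
  refine ⟨{v | Even (T.dist r v)}, fun x y h => ?_⟩
  rcases hT.dist_eq_dist_add_one_of_adj r h with h | h <;>
    simp [h, Nat.even_add_one]

/-- A nonempty multiset of edges of a tree has an edge `s(v, p)` such that no other edge of the
multiset meets `v`. -/
theorem SimpleGraph.IsTree.exists_pendant (hT : T.IsTree) {M : Multiset (Sym2 V)}
    (hM : ∀ e ∈ M, e ∈ T.edgeSet) (h0 : M ≠ 0) :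
    ∃ v p, s(v, p) ∈ M ∧ ∀ e ∈ M, v ∈ e → e = s(v, p) := by
  classical
  obtain ⟨r⟩ := hT.connected.nonempty
  obtain ⟨e₀, he₀⟩ := Multiset.exists_mem_of_ne_zero h0
  -- Take `v` as far from the root as possible among endpoints of edges of `M`; every such edge at
  -- `v` then leads to its parent. The sum of all endpoint distances is merely a bound ensuring that
  -- the maximum exists.
  obtain ⟨⟨v, p⟩, hvp, hmax⟩ := Nat.exists_forall_le_of_bounded
    (P := fun a : V × V => s(a.1, a.2) ∈ M) (fun a => T.dist r a.1)
    (M.map fun e => (e.lift ⟨fun x y => T.dist r x + T.dist r y,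
      fun x y => add_comm _ _⟩ : ℕ)).sum
    (fun a ha => by
      refine le_trans ?_ (Multiset.le_sum_of_mem (Multiset.mem_map_of_mem _ ha))
      simp) (by
      induction e₀ with
      | _ x y => exact ⟨(x, y), he₀⟩)
  have key : ∀ q, s(v, q) ∈ M → T.Adj q v ∧ T.dist r v = T.dist r q + 1 := fun q hq => by
    have hadj : T.Adj v q := hM _ hq
    have h1 := hmax (q, v) (by rwa [Sym2.eq_swap])
    refine ⟨hadj.symm, ?_⟩
    rcases hT.dist_eq_dist_add_one_of_adj r hadj with h | h
    · exact h
    · simp only at h1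
      omega
  refine ⟨v, p, hvp, fun e he hve => ?_⟩
  obtain ⟨q, rfl⟩ := Sym2.mem_iff_exists.1 hve
  rw [hT.eq_of_adj_of_dist_eq_add_one (key q he).1 (key p hvp).1 (key q he).2 (key p hvp).2]

/-- A multiset of edges of a tree with degrees at most `N * d` splits into `N` multisets with
degrees at most `d`. -/
theorem SimpleGraph.IsTree.exists_split (hT : T.IsTree) (N d : ℕ) (M : Multiset (Sym2 V))
    (hM : IsEdgePacking T (fun _ => N * d) M) :
    ∃ f : Fin N → Multiset (Sym2 V), ∑ k, f k = M ∧ ∀ k, IsEdgePacking T (fun _ => d) (f k) := by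
  classical
  induction hn : M.card generalizing M with
  | zero =>
    rw [Multiset.card_eq_zero] at hn
    exact ⟨fun _ => 0, by simp [hn], fun _ => isEdgePacking_zero⟩
  | succ n ih =>
    have h0 : M ≠ 0 := by
      rintro rfl
      simp at hn
    obtain ⟨v, p, hvp, hpend⟩ := hT.exists_pendant hM.mem_edgeSet h0
    obtain ⟨R, rfl⟩ := Multiset.exists_cons_of_mem hvp
    have hadj : T.Adj v p := hM.mem_edgeSet _ hvp
    obtain ⟨f, hf, hfk⟩ := ih R ⟨fun e he => hM.mem_edgeSet e (Multiset.mem_cons_of_mem he),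
      fun u => le_trans (by rw [edgeDegree_cons]; omega) (hM.degree_le u)⟩ (by simpa using hn)
    -- Without the removed edge, `p` has total degree less than `N * d`, so some part has room at
    -- `p`. As all remaining edges at `v` are copies of `s(v, p)`, that part also has room at `v`.
    obtain ⟨k, hk⟩ : ∃ k, edgeDegree (f k) p < d := by
      by_contra! hc
      have h1 := hM.degree_le p
      rw [edgeDegree_cons, ← hf, edgeDegree_sum] at h1
      have h2 := Finset.card_nsmul_le_sum Finset.univ (fun k => edgeDegree (f k) p) d
        fun k _ => hc k
      simp at h1 h2
      omega
    have hvk : edgeDegree (f k) v ≤ edgeDegree (f k) p := by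
      rw [edgeDegree, edgeDegree, Multiset.countP_eq_card_filter,
        Multiset.countP_eq_card_filter]
      refine Multiset.card_le_card (Multiset.le_filter.2 ⟨Multiset.filter_le _ _, fun e he => ?_⟩)
      rw [Multiset.mem_filter] at he
      have : e ∈ R := by
        rw [← hf]
        exact Multiset.mem_of_le (Finset.single_le_sum (f := f) (fun _ _ => zero_le)
          (Finset.mem_univ k)) he.1
      rw [hpend e (Multiset.mem_cons_of_mem this) he.2]
      simp
    refine ⟨Function.update f k (s(v, p) ::ₘ f k), ?_, fun j => ?_⟩
    · rw [Finset.sum_update_of_mem (Finset.mem_univ k), ← hf, Multiset.cons_add,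
        ← Finset.add_sum_erase _ f (Finset.mem_univ k), Finset.sdiff_singleton_eq_erase]
    · by_cases hj : j = k
      · subst hj
        rw [Function.update_self]
        exact (hfk j).cons hadj (hvk.trans_lt hk) hk
      · rw [Function.update_of_ne hj]
        exact hfk j

/-- A maximal packing with degrees at most `N * d` in a tree splits into `N` maximal packings with
degrees at most `d`. -/
theorem IsMaxEdgePacking.exists_split (hT : T.IsTree) {N d : ℕ} {M : Multiset (Sym2 V)}
    (hM : IsMaxEdgePacking T (fun _ => N * d) M) :
    ∃ f : Fin N → Multiset (Sym2 V), ∑ k, f k = M ∧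
      ∀ k, IsMaxEdgePacking T (fun _ => d) (f k) := by
  obtain ⟨f, hf, hfk⟩ := hT.exists_split N d M hM.toIsEdgePacking
  refine ⟨f, hf, fun k => ⟨hfk k, fun L hL => ?_⟩⟩
  have hadd := Finset.add_sum_erase _ f (Finset.mem_univ k)
  -- Replacing the part `f k` by a larger `L` would give a packing with bound `N * d` larger than
  -- `M`.
  have hcard := hM.card_le (L + ∑ j ∈ Finset.univ.erase k, f j) ⟨fun e he => ?_, fun v => ?_⟩
  · rw [← hf, ← hadd, Multiset.card_add, Multiset.card_add] at hcard
    omega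
  · rcases Multiset.mem_add.1 he with he | he
    · exact hL.mem_edgeSet e he
    · exact hM.mem_edgeSet e (by rw [← hf, ← hadd]; exact Multiset.mem_add.2 (Or.inr he))
  · rw [edgeDegree_add, edgeDegree_sum]
    have h1 := Finset.sum_le_card_nsmul (Finset.univ.erase k) (fun j => edgeDegree (f j) v) d
      fun j _ => (hfk j).degree_le v
    have h2 := hL.degree_le v
    rw [Finset.card_erase_of_mem (Finset.mem_univ k), Finset.card_univ, Fintype.card_fin,
      smul_eq_mul] at h1
    obtain ⟨N, rfl⟩ := Nat.exists_eq_succ_of_ne_zero (Fin.pos k).ne'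
    rw [Nat.succ_sub_one] at h1
    rw [Nat.succ_mul]
    omega

/-- In a tree in which distinct leaves have distinct neighbours, every nonempty set `A` of vertices
has more than `|A| / 2` neighbours. -/
theorem SimpleGraph.IsTree.card_lt_two_mul_card_finsetNeighbors [Fintype V] [Nontrivial V]
    (hT : T.IsTree)
    (hleaf : ∀ x y z, T.Adj x z → T.Adj y z → (∀ u, T.Adj x u → u = z) →
      (∀ u, T.Adj y u → u = z) → x = y) {A : Finset V} (hA : A.Nonempty) :
    A.card < 2 * (T.finsetNeighbors A).card := by
  classical
  choose g hg using fun v => hT.connected.preconnected.exists_adj_of_nontrivial v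
  -- The root is chosen inside the neighbourhood of `A`. Leaves in `A` map injectively to their
  -- neighbours; every other element of `A` maps injectively to one of its children, and the root is
  -- nobody's child. Hence `|A| ≤ |N(A)| + (|N(A)| - 1)`.
  obtain ⟨a₀, ha₀⟩ := hA
  set r := g a₀ with hr
  have hrA : r ∈ T.finsetNeighbors A := SimpleGraph.mem_finsetNeighbors.2 ⟨a₀, ha₀, hg a₀⟩
  have hchild : ∀ a, (¬ ∀ u, T.Adj a u → u = g a) →
      ∃ u, T.Adj a u ∧ T.dist r u = T.dist r a + 1 := by
    intro a ha
    by_contra! hc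
    have hparent : ∀ u, T.Adj a u → T.dist r a = T.dist r u + 1 := fun u hu =>
      (hT.dist_eq_dist_add_one_of_adj r hu).resolve_right (hc u hu)
    exact ha fun u hu => hT.eq_of_adj_of_dist_eq_add_one hu.symm (hg a).symm (hparent u hu)
      (hparent _ (hg a))
  choose! h hh hhd using hchild
  have h1 : (A.filter fun a => ∀ u, T.Adj a u → u = g a).card ≤ (T.finsetNeighbors A).card := by
    refine Finset.card_le_card_of_injOn g (fun a ha => ?_) fun a ha b hb hab => ?_
    · exact SimpleGraph.mem_finsetNeighbors.2 ⟨a, (Finset.mem_filter.1 ha).1, hg a⟩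
    · have ha' := (Finset.mem_filter.1 ha).2
      have hb' := (Finset.mem_filter.1 hb).2
      exact hleaf a b (g a) (hg a) (hab ▸ hg b) ha' (hab ▸ hb')
  have h2 : (A.filter fun a => ¬ ∀ u, T.Adj a u → u = g a).card ≤
      ((T.finsetNeighbors A).erase r).card := by
    refine Finset.card_le_card_of_injOn h (fun a ha => ?_) fun a ha b hb hab => ?_
    · obtain ⟨haA, ha⟩ := Finset.mem_filter.1 ha
      refine Finset.mem_erase.2 ⟨fun h0 => ?_,
        SimpleGraph.mem_finsetNeighbors.2 ⟨a, haA, hh a ha⟩⟩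
      have := hhd a ha
      rw [h0, SimpleGraph.dist_self] at this
      omega
    · have ha' := (Finset.mem_filter.1 ha).2
      have hb' := (Finset.mem_filter.1 hb).2
      exact hT.eq_of_adj_of_dist_eq_add_one (hh a ha') (hab ▸ hh b hb') (hhd a ha')
        (hab ▸ hhd b hb')
  rw [Finset.card_erase_of_mem hrA] at h2
  have h3 := Finset.card_filter_add_card_filter_not (s := A) fun a => ∀ u, T.Adj a u → u = g a
  have h4 := Finset.card_pos.2 ⟨r, hrA⟩
  omega

end Tree

/-! ### From monomial ideals to packings -/

theorem monomial_mem_of_le {V K : Type*} [Field K] {I : Ideal (MvPolynomial V K)}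
    {a b : V →₀ ℕ} (hab : a ≤ b)
    (ha : MvPolynomial.monomial a (1 : K) ∈ I) : MvPolynomial.monomial b (1 : K) ∈ I := by
  have := I.mul_mem_left (MvPolynomial.monomial (b - a) (1 : K)) ha
  rwa [MvPolynomial.monomial_mul, tsub_add_cancel_of_le hab, one_mul] at this

theorem monomial_mem_span_iff {V K : Type*} [Field K] {S : Set (V →₀ ℕ)} {a : V →₀ ℕ} :
    MvPolynomial.monomial a (1 : K) ∈
      Ideal.span ((fun s => MvPolynomial.monomial s (1 : K)) '' S) ↔ ∃ s ∈ S, s ≤ a := by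
  classical
  rw [MvPolynomial.mem_ideal_span_monomial_image]
  simp [MvPolynomial.support_monomial]

section EdgeIdeal

variable {V : Type*} [Finite V] {K : Type*} [Field K] {G : SimpleGraph V}

/-- The exponent vector of the product of the edges in `M`. -/
noncomputable def edgeExponent (M : Multiset (Sym2 V)) : V →₀ ℕ :=
  Finsupp.equivFunOnFinite.symm (edgeDegree M)

@[simp] theorem edgeExponent_apply (M : Multiset (Sym2 V)) (v : V) :
    edgeExponent M v = edgeDegree M v := rfl

theorem edgeExponent_cons {x y : V} (hxy : x ≠ y) (M : Multiset (Sym2 V)) :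
    edgeExponent (s(x, y) ::ₘ M) =
      Finsupp.single x 1 + Finsupp.single y 1 + edgeExponent M := by
  classical
  ext v
  simp only [edgeExponent_apply, edgeDegree_cons, Finsupp.add_apply, Finsupp.single_apply,
    Sym2.mem_iff]
  by_cases h1 : v = x <;> by_cases h2 : v = y <;>
    simp_all [eq_comm, add_comm]

variable (K) in
theorem monomial_edgeExponent_mem {M : Multiset (Sym2 V)} (hM : ∀ e ∈ M, e ∈ G.edgeSet) :
    MvPolynomial.monomial (edgeExponent M) (1 : K) ∈ edgeIdeal K G ^ M.card := by
  induction M using Multiset.induction_on with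
  | empty => simp
  | cons e M ih =>
    have he := hM e (Multiset.mem_cons_self e M)
    induction e with
    | _ x y =>
      have hxy : G.Adj x y := he
      have h1 : MvPolynomial.X x * MvPolynomial.X y ∈ edgeIdeal K G :=
        Ideal.subset_span ⟨x, y, hxy, rfl⟩
      have h2 := Ideal.mul_mem_mul h1 (ih fun e he => hM e (Multiset.mem_cons_of_mem he))
      rw [edgeExponent_cons hxy.ne, Multiset.card_cons, pow_succ']
      simpa [MvPolynomial.X, MvPolynomial.monomial_mul] using h2

variable (K G) in
theorem edgeIdeal_pow_le (q : ℕ) : edgeIdeal K G ^ q ≤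
    Ideal.span ((fun s => MvPolynomial.monomial s (1 : K)) ''
      {s | ∃ M : Multiset (Sym2 V), (∀ e ∈ M, e ∈ G.edgeSet) ∧ M.card = q ∧
        edgeExponent M = s}) := by
  induction q with
  | zero =>
    have h : (1 : MvPolynomial V K) ∈ Ideal.span ((fun s => MvPolynomial.monomial s (1 : K)) ''
      {s | ∃ M : Multiset (Sym2 V), (∀ e ∈ M, e ∈ G.edgeSet) ∧ M.card = 0 ∧
        edgeExponent M = s}) := by
      refine Ideal.subset_span ⟨0, ⟨0, by simp, rfl, ?_⟩, rfl⟩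
      ext v
      simp
    rw [(Ideal.eq_top_iff_one _).2 h]
    exact le_top
  | succ q ih =>
    rw [pow_succ']
    refine (Ideal.mul_mono_right ih).trans ?_
    rw [edgeIdeal, Ideal.span_mul_span', Ideal.span_le]
    rintro _ ⟨_, ⟨x, y, hxy, rfl⟩, _, ⟨_, ⟨M, hM, rfl, rfl⟩, rfl⟩, rfl⟩
    refine Ideal.subset_span ⟨_, ⟨s(x, y) ::ₘ M, fun e he => ?_, by simp, rfl⟩, ?_⟩
    · rcases Multiset.mem_cons.1 he with rfl | he
      · exact hxy
      · exact hM e he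
    · simp [edgeExponent_cons hxy.ne, MvPolynomial.X, MvPolynomial.monomial_mul]

theorem monomial_mem_edgeIdeal_pow {q : ℕ} {a : V →₀ ℕ} :
    MvPolynomial.monomial a (1 : K) ∈ edgeIdeal K G ^ q ↔
      ∃ M : Multiset (Sym2 V), (∀ e ∈ M, e ∈ G.edgeSet) ∧ M.card = q ∧ edgeExponent M ≤ a := by
  constructor
  · intro h
    obtain ⟨_, ⟨M, hM, hq, rfl⟩, hle⟩ := monomial_mem_span_iff.1 (edgeIdeal_pow_le K G q h)
    exact ⟨M, hM, hq, hle⟩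
  · rintro ⟨M, hM, rfl, hle⟩
    exact monomial_mem_of_le hle (monomial_edgeExponent_mem K hM)

theorem monomial_mem_boundedIdeal {q : ℕ} {c : V → ℕ} {u : V →₀ ℕ} :
    MvPolynomial.monomial u (1 : K) ∈ boundedIdeal (edgeIdeal K G ^ q) c ↔
      ∃ M, IsEdgePacking G c M ∧ M.card = q ∧ edgeExponent M ≤ u := by
  have h : boundedIdeal (edgeIdeal K G ^ q) c =
      Ideal.span ((fun s => MvPolynomial.monomial s (1 : K)) '' {a : V →₀ ℕ |
        (∀ i, a i ≤ c i) ∧ MvPolynomial.monomial a (1 : K) ∈ edgeIdeal K G ^ q}) := by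
    rw [boundedIdeal]
    congr 1
    ext p
    simp [and_assoc, eq_comm]
  rw [h, monomial_mem_span_iff]
  constructor
  · rintro ⟨a, ⟨hac, ha⟩, hau⟩
    obtain ⟨M, hM, hq, hle⟩ := monomial_mem_edgeIdeal_pow.1 ha
    exact ⟨M, ⟨hM, fun v => (hle v).trans (hac v)⟩, hq, hle.trans hau⟩
  · rintro ⟨M, hM, rfl, hle⟩
    exact ⟨edgeExponent M, ⟨hM.degree_le, monomial_edgeExponent_mem K hM.mem_edgeSet⟩, hle⟩

theorem boundedIdeal_ne_bot {q : ℕ} {c : V → ℕ} :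
    boundedIdeal (edgeIdeal K G ^ q) c ≠ ⊥ ↔ ∃ M, IsEdgePacking G c M ∧ M.card = q := by
  constructor
  · intro h
    rw [boundedIdeal, Ne, Ideal.span_eq_bot] at h
    push Not at h
    obtain ⟨_, ⟨a, hac, ha, rfl⟩, -⟩ := h
    obtain ⟨M, hM, hq, hle⟩ := monomial_mem_edgeIdeal_pow.1 ha
    exact ⟨M, ⟨hM, fun v => (hle v).trans (hac v)⟩, hq⟩
  · rintro ⟨M, hM, hq⟩ h0
    have h : MvPolynomial.monomial (edgeExponent M) (1 : K) ∈
        boundedIdeal (edgeIdeal K G ^ q) c := monomial_mem_boundedIdeal.2 ⟨M, hM, hq, le_rfl⟩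
    rw [h0, Ideal.mem_bot, MvPolynomial.monomial_eq_zero] at h
    exact one_ne_zero h

end EdgeIdeal

section Polymatroid

variable {V : Type*} [Fintype V] {K : Type*} [Field K] {G : SimpleGraph V} {c : V → ℕ}

theorem IsMaxEdgePacking.maxBoundedPower_eq {M : Multiset (Sym2 V)}
    (hM : IsMaxEdgePacking G c M) : maxBoundedPower (edgeIdeal K G) c = M.card := by
  rw [maxBoundedPower]
  simp only [boundedIdeal_ne_bot]
  refine le_antisymm (csSup_le' ?_) ?_
  · rintro q ⟨-, L, hL, rfl⟩
    exact hM.card_le L hL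
  -- If the maximal size is 0, no `q ≥ 1` qualifies and the supremum takes its default value 0,
  -- which is still the size of `M`.
  · rcases Nat.eq_zero_or_pos M.card with h0 | h0
    · simp [h0]
    · refine le_csSup ⟨M.card, ?_⟩ ⟨h0, M, hM.toIsEdgePacking, rfl⟩
      rintro q ⟨-, L, hL, rfl⟩
      exact hM.card_le L hL

/-- Exponent vectors of packings of equal size have equal coordinate sums, so none properly divides
another and every maximal packing yields a minimal generator. -/
theorem mem_topBoundedGenerators {u : V →₀ ℕ} :
    u ∈ topBoundedGenerators K G c ↔ ∃ M, IsMaxEdgePacking G c M ∧ u = edgeExponent M := by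
  obtain ⟨M₀, hM₀, -⟩ := (isEdgePacking_zero (G := G) (c := c)).exists_max_degree_le
  have hmax : ∀ M, IsEdgePacking G c M → M.card = M₀.card → IsMaxEdgePacking G c M :=
    fun M hM h => ⟨hM, fun L hL => (hM₀.card_le L hL).trans h.ge⟩
  rw [topBoundedGenerators, hM₀.maxBoundedPower_eq, minimalMonomialGenerators, Set.mem_ofPred_eq]
  simp only [monomial_mem_boundedIdeal]
  constructor
  · rintro ⟨⟨M, hM, hq, hle⟩, hmin⟩
    exact ⟨M, hmax M hM hq, le_antisymm (hmin ⟨M, hM, hq, le_rfl⟩ hle) hle⟩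
  · rintro ⟨M, hM, rfl⟩
    have hq : M.card = M₀.card := le_antisymm (hM₀.card_le M hM.toIsEdgePacking)
      (hM.card_le M₀ hM₀.toIsEdgePacking)
    refine ⟨⟨M, hM.toIsEdgePacking, hq, le_rfl⟩, ?_⟩
    rintro a ⟨L, hL, hLq, hLa⟩ haM v
    refine le_trans (le_of_eq ?_) (hLa v)
    have hle : ∀ i ∈ Finset.univ, edgeDegree L i ≤ edgeDegree M i :=
      fun i _ => (hLa.trans haM) i
    have hsum : ∑ i, edgeDegree L i = ∑ i, edgeDegree M i := by
      rw [sum_edgeDegree G L hL.mem_edgeSet, sum_edgeDegree G M hM.mem_edgeSet, hLq, hq]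
    exact ((Finset.sum_eq_sum_iff_of_le hle).1 hsum v (Finset.mem_univ v)).symm

theorem mem_boundedPolymatroid {z : V → ℤ} :
    z ∈ boundedPolymatroid K G c ↔
      ∃ M, IsMaxEdgePacking G c M ∧ ∀ v, 0 ≤ z v ∧ z v ≤ edgeDegree M v := by
  simp only [boundedPolymatroid, mem_topBoundedGenerators, Set.mem_ofPred_eq]
  constructor
  · rintro ⟨_, ⟨M, hM, rfl⟩, a, ha, hz⟩
    refine ⟨M, hM, fun v => ?_⟩
    have h : a v ≤ edgeDegree M v := ha v
    rw [hz]
    omega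
  · rintro ⟨M, hM, hz⟩
    refine ⟨_, ⟨M, hM, rfl⟩, Finsupp.equivFunOnFinite.symm fun v => (z v).toNat,
      fun v => ?_, fun v => ?_⟩
    · have := hz v
      simp only [Finsupp.equivFunOnFinite_symm_apply_apply, edgeExponent_apply]
      omega
    · have := hz v
      simp only [Finsupp.equivFunOnFinite_symm_apply_apply]
      omega

end Polymatroid

/-! ### Geometry of the polytope -/

section Interior

variable {V : Type*} {P : Set (V → ℝ)}

/-- From an interior point one can move a little in the direction `d`, which increases `f`; so the
bound is not attained there. -/
theorem lt_of_mem_interior (f : (V → ℝ) →ₗ[ℝ] ℝ) {b : ℝ} (hf : ∀ p ∈ P, f p ≤ b)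
    {d : V → ℝ} (hd : 0 < f d) {p : V → ℝ} (hp : p ∈ interior P) : f p < b := by
  have hc : Continuous fun t : ℝ => p + t • d := by fun_prop
  have hnhds : ∀ᶠ t in nhds (0 : ℝ), p + t • d ∈ P :=
    hc.continuousAt.eventually (by simpa using mem_interior_iff_mem_nhds.1 hp)
  obtain ⟨t, ht, ht0⟩ := ((hnhds.filter_mono nhdsWithin_le_nhds).and
    (self_mem_nhdsWithin : ∀ᶠ t in nhdsWithin (0 : ℝ) (Set.Ioi 0), t ∈ Set.Ioi 0)).exists
  have h1 := hf _ ht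
  rw [map_add, map_smul, smul_eq_mul] at h1
  have := mul_pos ht0 hd
  linarith

end Interior

section Polytope

variable {V : Type*} {K : Type*} [Field K] {G : SimpleGraph V} {c : V → ℕ}

theorem le_of_mem_boundedPolytope (f : (V → ℝ) →ₗ[ℝ] ℝ) {b : ℝ}
    (hf : ∀ z ∈ boundedPolymatroid K G c, f (fun v => (z v : ℝ)) ≤ b) {p : V → ℝ}
    (hp : p ∈ boundedPolytope K G c) : f p ≤ b := by
  refine convexHull_min (t := {p | f p ≤ b}) ?_ (convex_halfSpace_le f.isLinear b) hp
  rintro _ ⟨z, hz, rfl⟩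
  exact hf z hz

theorem mem_boundedPolytope_of_mem {z : V → ℤ} (hz : z ∈ boundedPolymatroid K G c) :
    (fun v => (z v : ℝ)) ∈ boundedPolytope K G c :=
  subset_convexHull ℝ _ ⟨z, hz, rfl⟩

variable [Fintype V]

theorem nonneg_of_mem_boundedPolytope {p : V → ℝ} (hp : p ∈ boundedPolytope K G c) (v : V) :
    0 ≤ p v := by
  have := le_of_mem_boundedPolytope (-LinearMap.proj v) (b := 0) (fun z hz => by
    obtain ⟨M, -, h⟩ := mem_boundedPolymatroid.1 hz
    simpa using (h v).1) hp
  simpa using this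

theorem sum_le_of_mem_boundedPolytope {A : Finset V} {b : ℕ}
    (hb : ∀ M, IsMaxEdgePacking G c M → ∑ v ∈ A, edgeDegree M v ≤ b) {p : V → ℝ}
    (hp : p ∈ boundedPolytope K G c) : ∑ v ∈ A, p v ≤ b := by
  have := le_of_mem_boundedPolytope (∑ v ∈ A, LinearMap.proj v) (b := b) (fun z hz => by
    obtain ⟨M, hM, h⟩ := mem_boundedPolymatroid.1 hz
    have h1 : ∑ v ∈ A, z v ≤ ∑ v ∈ A, (edgeDegree M v : ℤ) :=
      Finset.sum_le_sum fun v _ => (h v).2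
    have h2 : ∑ v ∈ A, z v ≤ (b : ℤ) := h1.trans (by exact_mod_cast hb M hM)
    simp only [LinearMap.sum_apply, LinearMap.proj_apply]
    exact_mod_cast h2) hp
  simpa [LinearMap.sum_apply] using this

theorem sum_lt_of_mem_interior_boundedPolytope {A : Finset V} (hA : A.Nonempty) {b : ℕ}
    (hb : ∀ M, IsMaxEdgePacking G c M → ∑ v ∈ A, edgeDegree M v ≤ b) {p : V → ℝ}
    (hp : p ∈ interior (boundedPolytope K G c)) : ∑ v ∈ A, p v < b := by
  have := lt_of_mem_interior (∑ v ∈ A, LinearMap.proj v) (b := b) (d := fun _ => 1)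
    (fun p hp => by simpa [LinearMap.sum_apply] using sum_le_of_mem_boundedPolytope hb hp)
    (by simpa [LinearMap.sum_apply] using hA) hp
  simpa [LinearMap.sum_apply] using this

theorem pos_of_mem_interior_boundedPolytope {p : V → ℝ}
    (hp : p ∈ interior (boundedPolytope K G c)) (v : V) : 0 < p v := by
  have := lt_of_mem_interior (-LinearMap.proj v) (b := 0) (d := fun _ => -1)
    (fun p hp => by simpa using nonneg_of_mem_boundedPolytope hp v) (by simp) hp
  simpa using this

theorem boundedPolymatroid_finite : (boundedPolymatroid K G c).Finite := by
  classical
  refine (Set.finite_Icc (0 : V → ℤ) fun v => (c v : ℤ)).subset fun z hz => ?_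
  obtain ⟨M, hM, h⟩ := mem_boundedPolymatroid.1 hz
  exact ⟨fun v => (h v).1, fun v => (h v).2.trans (Nat.cast_le.2 (hM.degree_le v))⟩

theorem isLatticePolytope_boundedPolytope
    (h : (interior (boundedPolytope K G c)).Nonempty) :
    IsLatticePolytope (boundedPolytope K G c) := by
  refine ⟨⟨_, boundedPolymatroid_finite.image _, rfl⟩, ?_, ?_⟩
  · exact ((convex_convexHull ℝ _).interior_nonempty_iff_affineSpan_eq_top).1 h
  · refine extremePoints_convexHull_subset.trans ?_
    rintro _ ⟨z, -, rfl⟩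
    exact ⟨z, rfl⟩

end Polytope

/-- Used coordinatewise to lower a sum of degree vectors to a prescribed smaller vector while
keeping it a sum of dominated vectors. -/
theorem exists_sum_eq_of_le_sum {ι : Type*} (s : Finset ι) (d : ι → ℕ) (w : ℕ)
    (h : w ≤ ∑ k ∈ s, d k) : ∃ b : ι → ℕ, (∀ k, b k ≤ d k) ∧ ∑ k ∈ s, b k = w := by
  classical
  induction s using Finset.induction_on generalizing w with
  | empty => exact ⟨0, fun k => Nat.zero_le _, by simpa using (Nat.le_zero.1 h).symm⟩
  | insert a s ha ih =>
    rw [Finset.sum_insert ha] at h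
    obtain ⟨b, hb, hsum⟩ := ih (w - d a) (by omega)
    refine ⟨Function.update b a (min w (d a)), fun k => ?_, ?_⟩
    · by_cases hk : k = a
      · subst hk
        simp
      · simpa [hk] using hb k
    · rw [Finset.sum_insert ha, Function.update_self, Finset.sum_congr rfl (g := b)
        fun k hk => Function.update_of_ne (ne_of_mem_of_not_mem hk ha) _ _, hsum]
      omega

/-! ### Normality and the interior point for constant labels -/

section Tree

variable {V : Type*} [Fintype V] {K : Type*} [Field K] {T : SimpleGraph V}

/-- For the constant bound `d`, Hall's condition gives the integer decomposition property. -/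
theorem SimpleGraph.IsTree.exists_sum_boundedPolymatroid (hT : T.IsTree) {N d : ℕ} {w : V → ℕ}
    (hw : ∀ v, w v ≤ N * d)
    (hall : ∀ A : Finset V, ∑ v ∈ A, w v ≤ N * d * (T.finsetNeighbors A).card) :
    ∃ b : Fin N → V → ℤ, (∀ k, b k ∈ boundedPolymatroid K T fun _ => d) ∧
      ∀ v, ∑ k, b k v = w v := by
  obtain ⟨X, hX⟩ := hT.exists_bipartition
  obtain ⟨M, hM, hMw⟩ := exists_isMaxEdgePacking_of_hall hX hw hall
  obtain ⟨f, rfl, hfk⟩ := hM.exists_split hT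
  choose b hb hsum using fun v => exists_sum_eq_of_le_sum Finset.univ
    (fun k => edgeDegree (f k) v) (w v) (by simpa [edgeDegree_sum] using hMw v)
  refine ⟨fun k v => b v k, fun k => mem_boundedPolymatroid.2 ⟨f k, hfk k, fun v => ?_⟩,
    fun v => ?_⟩
  · have := hb v k
    dsimp only
    omega
  · dsimp only
    exact_mod_cast hsum v

/-- The inequalities `p v ≤ d` and `p(A) ≤ d * |N(A)|` hold on the polytope because degree vectors
satisfy them. Multiplied by `N`, they are the hypotheses needed to decompose a lattice point of the
dilate. -/
theorem SimpleGraph.IsTree.isNormalPolytope_boundedPolytope (hT : T.IsTree) {d : ℕ}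
    (h : (interior (boundedPolytope K T fun _ => d)).Nonempty) :
    IsNormalPolytope (boundedPolytope K T fun _ => d) := by
  refine ⟨isLatticePolytope_boundedPolytope h, fun N _ a ha => ?_⟩
  obtain ⟨⟨p, hp, hpa⟩, z, rfl⟩ := ha
  have hzp : ∀ v, (z v : ℝ) = N * p v := fun v => by simpa using (congrFun hpa v).symm
  have hz0 : ∀ v, 0 ≤ z v := fun v => by
    have : (0 : ℝ) ≤ z v := by
      rw [hzp]
      exact mul_nonneg (Nat.cast_nonneg _) (nonneg_of_mem_boundedPolytope hp v)
    exact_mod_cast this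
  lift z to V → ℕ using hz0
  have hsum : ∀ (A : Finset V) (b : ℕ),
      (∀ M, IsMaxEdgePacking T (fun _ => d) M → ∑ v ∈ A, edgeDegree M v ≤ b) →
      ∑ v ∈ A, z v ≤ N * b := fun A b hb => by
    have h1 := sum_le_of_mem_boundedPolytope hb hp
    have h2 : (∑ v ∈ A, (z v : ℝ)) ≤ N * b := by
      have h3 : ∀ v ∈ A, (z v : ℝ) = N * p v := fun v _ => by simpa using hzp v
      rw [Finset.sum_congr rfl h3, ← Finset.mul_sum]
      exact mul_le_mul_of_nonneg_left h1 (Nat.cast_nonneg _)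
    exact_mod_cast h2
  obtain ⟨b, hb, hbz⟩ := hT.exists_sum_boundedPolymatroid (K := K) (N := N) (d := d) (w := z)
    (fun v => by simpa using hsum {v} d fun M hM => by simpa using hM.degree_le v)
    (fun A => by
      rw [mul_assoc]
      refine hsum A _ fun M hM => (sum_edgeDegree_le hM.mem_edgeSet A).trans ?_
      have := Finset.sum_le_card_nsmul (T.finsetNeighbors A) (edgeDegree M) d
        fun v _ => hM.degree_le v
      rwa [smul_eq_mul, mul_comm] at this)
  refine ⟨fun k v => b k v, fun k => ⟨mem_boundedPolytope_of_mem (hb k), b k, rfl⟩, ?_⟩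
  ext v
  have := hbz v
  rw [Finset.sum_apply]
  dsimp only
  exact_mod_cast this.symm

/-- If every nonempty set `A` of vertices of a tree has more than `|A| / 2` neighbours, then for
the constant bound `2` the all-one vector is an interior point. -/
theorem SimpleGraph.IsTree.one_mem_interior_boundedPolytope (hT : T.IsTree)
    (hN : ∀ A : Finset V, A.Nonempty → A.card < 2 * (T.finsetNeighbors A).card) :
    (fun _ => 1) ∈ interior (boundedPolytope K T fun _ => 2) := by
  classical
  have hne := hT.connected.nonempty
  set n := Fintype.card V with hn
  have hn0 : 0 < n := Fintype.card_pos
  have hn0' : (0 : ℝ) < n := by exact_mod_cast hn0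
  -- The cube `[0, t]^V` will be a neighbourhood of the all-one vector inside the polytope. This `t
  -- > 1` makes `n * t` an integer and is small enough for Hall: `|A| + 1 ≤ 2 * |N(A)|` and `|A| ≤
  -- n` give `(n + 1) * |A| ≤ 2 * n * |N(A)|`.
  set t : ℝ := (n + 1) / n with ht
  have ht1 : 1 < t := by rw [ht, lt_div_iff₀ hn0']; linarith
  have hbox : Set.univ.pi (fun _ : V => Set.Icc 0 t) ⊆ boundedPolytope K T fun _ => 2 := by
    have h1 : (fun _ : V => Set.Icc 0 t) = fun _ => convexHull ℝ {0, t} := by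
      rw [convexHull_pair, segment_eq_Icc (by linarith)]
    rw [h1, ← convexHull_pi]
    refine convexHull_min (fun p hp => ?_) (convex_convexHull ℝ _)
    -- For a vertex `p` of the cube, `n • p` is a sum of `n` points of `D(T, 2)`, so `p` is their
    -- average.
    obtain ⟨b, hb, hbw⟩ := hT.exists_sum_boundedPolymatroid (K := K) (N := n) (d := 2)
      (w := fun v => if p v = t then n + 1 else 0) (fun v => by split_ifs <;> omega) (fun A => by
        rcases A.eq_empty_or_nonempty with rfl | hA
        · simp
        have h2 : ∑ v ∈ A, (if p v = t then n + 1 else 0) ≤ A.card * (n + 1) :=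
          Finset.sum_le_card_nsmul A _ (n + 1) fun v _ => by split_ifs <;> omega
        have h3 := hN A hA
        have h4 : A.card ≤ n := Finset.card_le_univ A
        nlinarith)
    have hp' : p = ∑ k, (1 / n : ℝ) • fun v => (b k v : ℝ) := by
      ext v
      have h2 : (∑ k, (b k v : ℝ)) = if p v = t then (n : ℝ) + 1 else 0 := by
        exact_mod_cast hbw v
      simp only [Finset.sum_apply, Pi.smul_apply, smul_eq_mul, ← Finset.mul_sum, h2]
      rcases hp v (Set.mem_univ v) with h | h
      · rw [if_neg (by rw [h]; linarith), h, mul_zero]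
      · rw [Set.mem_singleton_iff] at h
        rw [if_pos h, h, ht]
        ring
    rw [hp']
    refine (convex_convexHull ℝ _).sum_mem (fun _ _ => by positivity) ?_
      fun k _ => mem_boundedPolytope_of_mem (hb k)
    simp [hn0'.ne']
  refine mem_interior_iff_mem_nhds.2 (Filter.mem_of_superset ?_ hbox)
  exact set_pi_mem_nhds Set.finite_univ fun v _ => Icc_mem_nhds one_pos ht1

theorem SimpleGraph.IsTree.isPseudoGorensteinStar_boundedPolytope (hT : T.IsTree)
    (hN : ∀ A : Finset V, A.Nonempty → A.card < 2 * (T.finsetNeighbors A).card) :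
    IsPseudoGorensteinStar (boundedPolytope K T fun _ => 2) := by
  have h1 := hT.one_mem_interior_boundedPolytope (K := K) hN
  refine ⟨hT.isNormalPolytope_boundedPolytope ⟨_, h1⟩, Set.ncard_eq_one.2 ⟨fun _ => 1, ?_⟩⟩
  refine Set.eq_singleton_iff_unique_mem.2 ⟨⟨h1, fun _ => 1, by simp⟩, ?_⟩
  rintro _ ⟨hp, z, rfl⟩
  ext v
  have h2 := pos_of_mem_interior_boundedPolytope hp v
  have h3 := sum_lt_of_mem_interior_boundedPolytope (A := {v}) (b := 2) ⟨v, by simp⟩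
    (fun M hM => by simpa using hM.degree_le v) hp
  rw [Finset.sum_singleton] at h3
  dsimp only at h2 h3
  have h4 : 0 < z v := by exact_mod_cast h2
  have h5 : z v < 2 := by exact_mod_cast h3
  have : z v = 1 := by omega
  simp [this]

end Tree

/-! ### Two leaves with a common neighbour -/

section CommonNeighbor

variable {V : Type*} [Fintype V] {K : Type*} [Field K] {G : SimpleGraph V} {c : V → ℕ}

theorem edgeDegree_add_le_of_leaves {M : Multiset (Sym2 V)} (hM : ∀ e ∈ M, e ∈ G.edgeSet)
    {x y z : V} (hxy : x ≠ y) (hx : ∀ u, G.Adj x u → u = z) (hy : ∀ u, G.Adj y u → u = z) :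
    edgeDegree M x + edgeDegree M y ≤ edgeDegree M z := by
  classical
  have h := sum_edgeDegree_le hM {x, y}
  rw [Finset.sum_pair hxy] at h
  refine h.trans (le_trans (Finset.sum_le_sum_of_subset (t := {z}) fun u hu => ?_) (by simp))
  obtain ⟨a, ha, hau⟩ := SimpleGraph.mem_finsetNeighbors.1 hu
  rcases Finset.mem_insert.1 ha with rfl | ha
  · simpa using hx u hau
  · rw [Finset.mem_singleton.1 ha] at hau
    simpa using hy u hau

/-- If `x` and `z` both had room, the edge `s(x, z)` could be added. -/
theorem IsMaxEdgePacking.le_edgeDegree {V : Type*} {G : SimpleGraph V} {c : V → ℕ}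
    {M : Multiset (Sym2 V)} (hM : IsMaxEdgePacking G c M) {x z : V} (hxz : G.Adj x z) (hz : edgeDegree M z < c z) : c x ≤ edgeDegree M x := by
  by_contra! hx
  have := hM.card_le _ (hM.toIsEdgePacking.cons hxz hx hz)
  simp at this

/-- If every maximal packing has degree at least `m` at `z`, then the `z`-coordinate of an interior
point can be moved freely between `0` and `m`. -/
theorem update_mem_interior_boundedPolytope [DecidableEq V] {z : V} {m : ℕ}
    (hm : ∀ M, IsMaxEdgePacking G c M → m ≤ edgeDegree M z) {p : V → ℝ}
    (hp : p ∈ interior (boundedPolytope K G c)) {t : ℝ} (ht : t ∈ Set.Ioo (0 : ℝ) m) :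
    Function.update p z t ∈ interior (boundedPolytope K G c) := by
  -- For an integer `s ≤ m` the update maps `D(G, c)` into itself, since the dominating packing can
  -- be kept; being affine, it also preserves the convex hull. Interpolating between `s = 0` and `s
  -- = m` then covers real values.
  have hend : ∀ s : ℕ, s ≤ m → ∀ q ∈ boundedPolytope K G c,
      Function.update q z (s : ℝ) ∈ boundedPolytope K G c := by
    intro s hs q hq
    have hconv : Convex ℝ {q : V → ℝ | Function.update q z (s : ℝ) ∈ boundedPolytope K G c} := by
      intro q₁ h₁ q₂ h₂ a b ha hb hab
      have h := convex_convexHull ℝ _ h₁ h₂ ha hb hab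
      have he : Function.update (a • q₁ + b • q₂) z (s : ℝ) =
          a • Function.update q₁ z (s : ℝ) + b • Function.update q₂ z (s : ℝ) := by
        ext v
        by_cases hv : v = z
        · subst hv
          simp [← add_mul, hab]
        · simp [hv]
      rw [Set.mem_ofPred_eq, he]
      exact h
    refine convexHull_min ?_ hconv hq
    rintro _ ⟨x, hx, rfl⟩
    obtain ⟨M, hM, h⟩ := mem_boundedPolymatroid.1 hx
    have hmem : Function.update x z (s : ℤ) ∈ boundedPolymatroid K G c := by
      refine mem_boundedPolymatroid.2 ⟨M, hM, fun v => ?_⟩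
      by_cases hv : v = z
      · subst hv
        have := hm M hM
        simp only [Function.update_self]
        omega
      · simpa [hv] using h v
    have he : Function.update (fun v => (x v : ℝ)) z (s : ℝ) =
        fun v => ((Function.update x z (s : ℤ) v : ℤ) : ℝ) := by
      ext v
      by_cases hv : v = z
      · subst hv
        simp
      · simp [hv]
    rw [Set.mem_ofPred_eq, he]
    exact mem_boundedPolytope_of_mem hmem
  have hmid : ∀ q ∈ boundedPolytope K G c, ∀ s ∈ Set.Icc (0 : ℝ) m,
      Function.update q z s ∈ boundedPolytope K G c := by
    intro q hq s hs
    have hm0 : (0 : ℝ) < m := ht.1.trans ht.2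
    have h := convex_convexHull ℝ _ (hend 0 (Nat.zero_le _) q hq) (hend m le_rfl q hq)
      (a := 1 - s / m) (b := s / m) (by rw [sub_nonneg, div_le_one hm0]; exact hs.2)
      (div_nonneg hs.1 hm0.le) (by ring)
    have he : Function.update q z s = (1 - s / m) • Function.update q z ((0 : ℕ) : ℝ) +
        (s / m) • Function.update q z (m : ℝ) := by
      ext v
      by_cases hv : v = z
      · subst hv
        simp [hm0.ne']
      · simp only [Function.update_of_ne hv, Pi.add_apply, Pi.smul_apply, smul_eq_mul]
        ring
    rw [he]
    exact h
  -- Points with `z`-coordinate in `(0, m)` whose update to `p z` is interior form an open set;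
  -- restoring their own `z`-coordinate shows that this set lies in the polytope.
  have hopen : IsOpen {q : V → ℝ | Function.update q z (p z) ∈ interior (boundedPolytope K G c) ∧
      q z ∈ Set.Ioo (0 : ℝ) m} :=
    (isOpen_interior.preimage (continuous_id.update z continuous_const)).inter
      (isOpen_Ioo.preimage (continuous_apply z))
  refine interior_maximal (fun q hq => ?_) hopen ⟨?_, ?_⟩
  · have := hmid _ (interior_subset hq.1) (q z) ⟨hq.2.1.le, hq.2.2.le⟩
    simpa using this
  · simpa using hp
  · simpa using ht

theorem not_isLabelingPseudoGorensteinStar_of_leaves {x y z : V} (hxy : x ≠ y)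
    (hxz : G.Adj x z) (hyz : G.Adj y z) (hx : ∀ u, G.Adj x u → u = z)
    (hy : ∀ u, G.Adj y u → u = z) : ¬ IsLabelingPseudoGorensteinStar K G := by
  classical
  rintro ⟨c, -, -, hcard⟩
  obtain ⟨p, hpeq⟩ := Set.ncard_eq_one.1 hcard
  obtain ⟨hp, a, rfl⟩ : p ∈ interior (boundedPolytope K G c) ∩ latticePoints V := by
    rw [hpeq]; rfl
  have hpos : ∀ v, 0 < a v := fun v => by
    have := pos_of_mem_interior_boundedPolytope hp v
    dsimp only at this
    exact_mod_cast this
  have hlt : ∀ v, a v < c v := fun v => by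
    have := sum_lt_of_mem_interior_boundedPolytope (A := {v}) (b := c v) ⟨v, by simp⟩
      (fun M hM => by simpa using hM.degree_le v) hp
    rw [Finset.sum_singleton] at this
    dsimp only at this
    exact_mod_cast this
  have hsum : a x + a y < c z := by
    have := sum_lt_of_mem_interior_boundedPolytope (A := {x, y}) (b := c z) ⟨x, by simp⟩
      (fun M hM => by
        rw [Finset.sum_pair hxy]
        exact (edgeDegree_add_le_of_leaves hM.mem_edgeSet hxy hx hy).trans (hM.degree_le z)) hp
    rw [Finset.sum_pair hxy] at this
    dsimp only at this
    exact_mod_cast this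
  have hx0 := hpos x
  have hy0 := hpos y
  have hxc := hlt x
  have hyc := hlt y
  -- If the degree at `z` were at most 2, then `z` would be unsaturated because `c z ≥ 3`. So `x`
  -- and `y` would be saturated, forcing degree at least `c x + c y ≥ 4` at `z`.
  have hdeg : ∀ M, IsMaxEdgePacking G c M → 3 ≤ edgeDegree M z := fun M hM => by
    by_contra! h
    have h1 := hM.le_edgeDegree hxz (by omega)
    have h2 := hM.le_edgeDegree hyz (by omega)
    have h3 := edgeDegree_add_le_of_leaves hM.mem_edgeSet hxy hx hy
    omega
  have hmem : ∀ t : ℤ, 0 < t → t < 3 → (t : ℝ) = a z := fun t ht0 ht3 => by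
    have hin := update_mem_interior_boundedPolytope hdeg hp (t := t)
      ⟨by exact_mod_cast ht0, by exact_mod_cast ht3⟩
    have : Function.update (fun v => (a v : ℝ)) z (t : ℝ) ∈
        interior (boundedPolytope K G c) ∩ latticePoints V :=
      ⟨hin, Function.update a z t, by
        ext v
        by_cases hv : v = z
        · subst hv
          simp
        · simp [hv]⟩
    rw [hpeq, Set.mem_singleton_iff] at this
    simpa using congrFun this z
  have h1 := hmem 1 (by norm_num) (by norm_num)
  have h2 := hmem 2 (by norm_num) (by norm_num)
  rw [← h1] at h2
  norm_num at h2

end CommonNeighbor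

theorem theorem4p3 {V : Type*} [Fintype V] (K : Type*) [Field K]
    (T : SimpleGraph V) [DecidableRel T.Adj] (hT : T.IsTree) (hn : 2 ≤ Fintype.card V) :
    IsLabelingPseudoGorensteinStar K T ↔
      ∀ x y : V, T.degree x = 1 → T.degree y = 1 → T.dist x y ≠ 2 := by
  have : Nontrivial V := Fintype.one_lt_card_iff_nontrivial.1 hn
  constructor
  · intro h x y hx hy hd
    rw [SimpleGraph.degree_eq_one_iff_existsUnique_adj] at hx hy
    obtain ⟨p, hp⟩ := hT.connected.exists_walk_length_eq_dist x y
    rw [hd] at hp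
    obtain ⟨z, hxz, hzy⟩ : ∃ z, T.Adj x z ∧ T.Adj z y := by
      cases p with
      | nil => simp at hp
      | cons h q =>
        refine ⟨_, h, SimpleGraph.Walk.adj_of_length_eq_one (p := q) ?_⟩
        simpa using hp
    refine not_isLabelingPseudoGorensteinStar_of_leaves (K := K) ?_ hxz hzy.symm
      (fun u hu => hx.unique hu hxz) (fun u hu => hy.unique hu hzy.symm) h
    rintro rfl
    simp at hd
  · intro h
    refine ⟨fun _ => 2, fun _ => two_pos, hT.isPseudoGorensteinStar_boundedPolytope fun A hA =>
      hT.card_lt_two_mul_card_finsetNeighbors (fun x y z hxz hyz hx hy => ?_) hA⟩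
    by_contra hxy
    refine h x y (SimpleGraph.degree_eq_one_iff_existsUnique_adj.2 ⟨z, hxz, hx⟩)
      (SimpleGraph.degree_eq_one_iff_existsUnique_adj.2 ⟨z, hyz, hy⟩) (le_antisymm ?_ ?_)
    · exact SimpleGraph.dist_le (.cons hxz (.cons hyz.symm .nil))
    · have h0 := hT.connected.pos_dist_of_ne hxy
      -- Adjacency of `x` and `y` would make `y` the only neighbour `z` of `x`, but `y` is adjacent
      -- to `z`.
      have h1 : T.dist x y ≠ 1 := fun h1 => by
        have hadj : T.Adj x y := SimpleGraph.dist_eq_one_iff_adj.1 h1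
        exact hyz.ne (hx y hadj)
      omega
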